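/- Let $(X,\tau)$ be a Polish space and let $\mathsf d:X\times X\to[0,\infty]$ be a complete extended distance on $X$ (a distance allowed to take the value $\infty$) such that $\mathsf d(x_n,x)\to0$ implies $x_n\to x$ in $\tau$, and $\mathsf d$ is lower semicontinuous with respect to $\tau\times\tau$. Let $\mathfrak m$ be a $\sigma$-finite Borel measure on $X$ and let $V:X\to[0,\infty)$ be a Borel and $\mathsf d$-Lipschitz function with $\int_X e^{-V^2}\,d\mathfrak m\le 1$. Denote by $\mathscr P(X)$ the set of Borel probability measures on $X$, equipped with the extended Wasserstein distance $$W_2(\mu,\nu)=\Big(\inf_{\gamma}\int_{X\times X}\mathsf d^2(x,y)\,d\gamma(x,y)\Big)^{1/2}\in[0,\infty],$$ the infimum being over all couplings $\gamma$ of $\mu$ and $\nu$. Define the relative entropy $\mathrm{Ent}:\mathscr P(X)\to(-\infty,+\infty]$ by $$\mathrm{Ent}(\mu)=\int_X\rho\log\rho\,d\mathfrak m\quad\text{if }\mu=\rho\,\mathfrak m\text{ and }\int_X V^2\,d\mu<\infty,\qquad \mathrm{Ent}(\mu)=+\infty\quad\text{otherwise},$$ and its descending Wasserstein slope by $$|\nabla^-\mathrm{Ent}|(\mu)=\limsup_{W_2(\nu,\mu)\to0,\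 \nu\neq\mu}\frac{[\mathrm{Ent}(\nu)-\mathrm{Ent}(\mu)]^-}{W_2(\nu,\mu)}\in[0,\infty]\quad\text{if }\mathrm{Ent}(\mu)<\infty$$ (equal to $0$ if $\mu$ is isolated in $(\mathscr P(X),W_2)$), where $r^-=\max\{-r,0\}$, and $|\nabla^-\mathrm{Ent}|(\mu)=+\infty$ if $\mathrm{Ent}(\mu)=+\infty$. Then $|\nabla^-\mathrm{Ent}|^2$ is convex with respect to linear interpolation of measures: for all $\mu_1,\mu_2\in\mathscr P(X)$ and all $\alpha_1,\alpha_2\ge0$ with $\alpha_1+\alpha_2=1$, $$|\nabla^-\mathrm{Ent}|^2(\alpha_1\mu_1+\alpha_2\mu_2)\le\alpha_1|\nabla^-\mathrm{Ent}|^2(\mu_1)+\alpha_2|\nabla^-\mathrm{Ent}|^2(\mu_2)$$ in $[0,\infty]$, with the convention $0\cdot\infty=0$. -/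

import Mathlib

open MeasureTheory Filter Topology
open scoped ENNReal NNReal

noncomputable section

/-- `d` is an extended distance on `X` (a distance that may take the value `∞`). -/
structure IsExtendedDistance {X : Type*} (d : X → X → ℝ≥0∞) : Prop where
  eq_zero_iff : ∀ x y, d x y = 0 ↔ x = y
  symm : ∀ x y, d x y = d y x
  triangle : ∀ x y z, d x y ≤ d x z + d z y

/-- `(X, τ, d)` is a Polish extended space, where `τ` is the ambient topology of `X`: `τ` is Polish,
`d` is a complete extended distance, `d`-convergence implies `τ`-convergence, and `d` is lower
semicontinuous for `τ × τ`. The topology `τ` need not be the one induced by `d`. -/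
structure IsPolishExtendedSpace (X : Type*) [TopologicalSpace X] (d : X → X → ℝ≥0∞) : Prop where
  polish : PolishSpace X
  extendedDistance : IsExtendedDistance d
  complete : ∀ u : ℕ → X,
    (∀ ε : ℝ≥0∞, 0 < ε → ∃ N, ∀ m ≥ N, ∀ n ≥ N, d (u m) (u n) < ε) →
      ∃ x, Tendsto (fun n => d (u n) x) atTop (𝓝 0)
  tendsto_of_dist : ∀ (u : ℕ → X) (x : X),
    Tendsto (fun n => d (u n) x) atTop (𝓝 0) → Tendsto u atTop (𝓝 x)
  lowerSemicontinuous : LowerSemicontinuous (fun p : X × X => d p.1 p.2)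

/-- `V : X → [0, ∞)` is a Borel, `d`-Lipschitz weight with `∫ e^{-V²} dm ≤ 1`. -/
structure IsEntropyWeight {X : Type*} [MeasurableSpace X] (d : X → X → ℝ≥0∞)
    (m : Measure X) (V : X → ℝ) : Prop where
  nonneg : ∀ x, 0 ≤ V x
  measurable : Measurable V
  lipschitz : ∃ C : ℝ≥0, ∀ x y, ENNReal.ofReal |V x - V y| ≤ C * d x y
  lintegral_exp_le : ∫⁻ x, ENNReal.ofReal (Real.exp (-(V x) ^ 2)) ∂m ≤ 1

/-- The quadratic Wasserstein (extended) distance `W₂` between probability measures: the square root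
of the infimum of `∫ d² dγ` over all couplings `γ` of `μ` and `ν`. -/
def wassersteinTwo {X : Type*} [MeasurableSpace X] (d : X → X → ℝ≥0∞)
    (μ ν : ProbabilityMeasure X) : ℝ≥0∞ :=
  (⨅ (γ : ProbabilityMeasure (X × X)) (_ : (γ : Measure (X × X)).map Prod.fst = (μ : Measure X))
    (_ : (γ : Measure (X × X)).map Prod.snd = (ν : Measure X)),
      ∫⁻ p, d p.1 p.2 ^ 2 ∂(γ : Measure (X × X))) ^ (1 / 2 : ℝ)

/-- The integral of a real function with respect to `m`, as the extended real number
`∫ g⁺ dm - ∫ g⁻ dm`. -/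
def extendedIntegral {X : Type*} [MeasurableSpace X] (m : Measure X) (g : X → ℝ) : EReal :=
  ((∫⁻ x, ENNReal.ofReal (g x) ∂m : ℝ≥0∞) : EReal) -
    ((∫⁻ x, ENNReal.ofReal (-g x) ∂m : ℝ≥0∞) : EReal)

open Classical in
/-- The relative entropy `Ent_m(μ) = ∫ ρ log ρ dm` if `μ = ρ m` and `∫ V² dμ < ∞`, and `+∞`
otherwise. -/
def relativeEntropy {X : Type*} [MeasurableSpace X] (m : Measure X) (V : X → ℝ)
    (μ : ProbabilityMeasure X) : EReal :=
  if (μ : Measure X) ≪ m ∧ ∫⁻ x, ENNReal.ofReal (V x ^ 2) ∂(μ : Measure X) < ∞ then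
    extendedIntegral m (fun x =>
      ((μ : Measure X).rnDeriv m x).toReal * Real.log ((μ : Measure X).rnDeriv m x).toReal)
  else ⊤

open Classical in
/-- The descending slope `|∇⁻f|(y) = limsup_{z → y} [f(z) - f(y)]⁻ / d(z, y)` of an extended-real
function on an extended metric space, the limit being taken over `z ≠ y`. It is `0` at isolated
points of the domain `{f ∈ ℝ}`, and `+∞` outside the domain. -/
def descendingSlope {Y : Type*} (d : Y → Y → ℝ≥0∞) (f : Y → EReal) (y : Y) : ℝ≥0∞ :=
  if f y ≠ ⊤ ∧ f y ≠ ⊥ then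
    ⨅ (r : ℝ≥0∞) (_ : 0 < r), ⨆ (z : Y) (_ : z ≠ y) (_ : d z y < r),
      (f y - f z).toENNReal / d z y
  else ∞

/-- The linear interpolation `a μ + b ν` of two probability measures, for `a, b ≥ 0`, `a + b = 1`. -/
def linearInterpolation {X : Type*} [MeasurableSpace X] (a b : ℝ≥0) (hab : a + b = 1)
    (μ ν : ProbabilityMeasure X) : ProbabilityMeasure X :=
  ⟨a • (μ : Measure X) + b • (ν : Measure X), ⟨by
    simp only [Measure.add_apply, Measure.smul_apply, measure_univ, ENNReal.smul_def, smul_eq_mul,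
      mul_one]
    exact_mod_cast hab⟩⟩

end

/-!
Let `μ = a μ₁ + b μ₂` with `a, b > 0`, let `ν` be `W₂`-close to `μ`, and let `γ` be a coupling of
`ν` and `μ`. Reweighting `γ` by the densities `dμᵢ/dμ` of its second coordinate splits it as
`γ = a γ₁ + b γ₂`, where `γᵢ` couples some `νᵢ` with `μᵢ` and `ν = a ν₁ + b ν₂`. Since
`μ` and `ν` dominate positive multiples of `μᵢ` and `νᵢ`, the densities `dμᵢ/dμ` and `dνᵢ/dν` are
bounded, and the chain rule
`log (dμᵢ/dm) = log (dμᵢ/dμ) + log (dμ/dm)` gives (`integral_llr_mixture`)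

  `a Ent(μ₁) + b Ent(μ₂) = Ent(μ) + a KL(μ₁ | μ) + b KL(μ₂ | μ)`,

and likewise for `ν`. As `νᵢ` and `ν` arise from `μᵢ` and `μ` through the same conditional laws, the
data processing inequality `KL(νᵢ | ν) ≤ KL(μᵢ | μ)` holds (`klDiv_map_fst_reweightPlan_le`), whence
(`exists_split_plan`)

  `Ent(μ) - Ent(ν) ≤ a (Ent(μ₁) - Ent(ν₁)) + b (Ent(μ₂) - Ent(ν₂))`,

while the costs satisfy `a cost(γ₁) + b cost(γ₂) = cost(γ)`. In particular `νᵢ` is `W₂`-close to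
`μᵢ`, so for `tᵢ` larger than the slope at `μᵢ` the drop `Ent(μᵢ) - Ent(νᵢ)` is at most
`tᵢ cost(γᵢ)^{1/2}`. The Cauchy–Schwarz inequality then yields
`(Ent(μ) - Ent(ν))² ≤ (a t₁² + b t₂²) cost(γ)` for drops that are positive
(`sq_drop_mixture_le`). Taking the infimum over `γ` bounds the slope at `μ`, and `tᵢ` decreases to
the slope at `μᵢ`. Optimal couplings are not needed. The integrability of `e^{-V²}` enters only to
exclude `Ent(ν) = -∞` (`relativeEntropy_ne_bot`).
-/

open InformationTheory

/-! ### Log-likelihood ratios of dominated measures -/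

theorem llr_chain {α : Type*} [MeasurableSpace α] {μ ν κ : Measure α} [SigmaFinite μ]
    [SigmaFinite ν] [SigmaFinite κ] (hμν : μ ≪ ν) (hνκ : ν ≪ κ) :
    llr μ κ =ᵐ[μ] fun x => llr μ ν x + llr ν κ x := by
  have hμκ := hμν.trans hνκ
  filter_upwards [hμκ.ae_le (Measure.rnDeriv_mul_rnDeriv (κ := κ) hμν),
    Measure.rnDeriv_pos hμν, hμν.ae_le (Measure.rnDeriv_lt_top μ ν),
    hμν.ae_le (Measure.rnDeriv_pos hνκ), hμκ.ae_le (Measure.rnDeriv_lt_top ν κ)]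
    with x h1 h2 h3 h4 h5
  simp only [llr, ← h1, Pi.mul_apply, ENNReal.toReal_mul]
  exact Real.log_mul (ENNReal.toReal_pos h2.ne' h3.ne).ne' (ENNReal.toReal_pos h4.ne' h5.ne).ne'

theorem absolutelyContinuous_of_smul_le {α : Type*} [MeasurableSpace α] {μ ν : Measure α}
    {a : ℝ≥0} (ha : a ≠ 0) (h : a • μ ≤ ν) : μ ≪ ν :=
  (Measure.absolutelyContinuous_smul (c := (a : ℝ≥0∞)) (by simpa using ha)).trans
    h.absolutelyContinuous

theorem integrable_of_smul_le {α : Type*} [MeasurableSpace α] {μ ν : Measure α} {a : ℝ≥0}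
    (ha : a ≠ 0) (h : a • μ ≤ ν) {f : α → ℝ} (hf : Integrable f ν) : Integrable f μ := by
  have hfa := hf.mono_measure h
  rw [← Measure.coe_nnreal_smul] at hfa
  exact (integrable_smul_measure (by simpa using ha) (by simp)).1 hfa

/-- If `a μ ≤ ν` with `a > 0`, the density `dμ/dν` is at most `a⁻¹`, so `t log t` is bounded along
it. -/
theorem integrable_llr_of_smul_le {α : Type*} [MeasurableSpace α] {μ ν : Measure α}
    [IsFiniteMeasure μ] [IsFiniteMeasure ν] {a : ℝ≥0} (ha : a ≠ 0) (h : a • μ ≤ ν) :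
    Integrable (llr μ ν) μ := by
  have hac := absolutelyContinuous_of_smul_le ha h
  rw [← integrable_rnDeriv_mul_log_iff hac]
  obtain ⟨C, hC⟩ := (isCompact_Icc (a := (0 : ℝ)) (b := (a : ℝ)⁻¹)).exists_bound_of_continuousOn
    Real.continuous_mul_log.continuousOn
  refine Integrable.of_bound (C := C) ?_ ?_
  · exact (Real.continuous_mul_log.measurable.comp
      (Measure.measurable_rnDeriv μ ν).ennreal_toReal).aestronglyMeasurable
  · filter_upwards [Measure.rnDeriv_le_one_of_le h, Measure.rnDeriv_smul_left μ ν a] with x h1 h2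
    refine hC _ ⟨ENNReal.toReal_nonneg, ?_⟩
    rw [h2] at h1
    have h3 := ENNReal.toReal_mono (by simp) h1
    have ha' : (0 : ℝ) < a := by positivity
    simp [ENNReal.smul_def] at h3
    rw [← one_div, le_div_iff₀ ha']
    linarith

/-- By the chain rule the two log-likelihood ratios differ by `llr μ ν`, which is `μ`-integrable. -/
theorem integrable_llr_iff_of_smul_le {α : Type*} [MeasurableSpace α] {μ ν κ : Measure α}
    [IsFiniteMeasure μ] [IsFiniteMeasure ν] [SigmaFinite κ] {a : ℝ≥0} (ha : a ≠ 0)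
    (h : a • μ ≤ ν) (hνκ : ν ≪ κ) :
    Integrable (llr μ κ) μ ↔ Integrable (llr ν κ) μ := by
  have hac := absolutelyContinuous_of_smul_le ha h
  rw [integrable_congr (llr_chain hac hνκ)]
  exact integrable_add_iff_integrable_right' (integrable_llr_of_smul_le ha h)

theorem integral_llr_eq_add {α : Type*} [MeasurableSpace α] {μ ν κ : Measure α}
    [IsProbabilityMeasure μ] [IsProbabilityMeasure ν] [SigmaFinite κ] {a : ℝ≥0} (ha : a ≠ 0)
    (h : a • μ ≤ ν) (hνκ : ν ≪ κ) (hint : Integrable (llr ν κ) μ) :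
    ∫ x, llr μ κ x ∂μ = (klDiv μ ν).toReal + ∫ x, llr ν κ x ∂μ := by
  have hac := absolutelyContinuous_of_smul_le ha h
  rw [integral_congr_ae (llr_chain hac hνκ),
    integral_add (integrable_llr_of_smul_le ha h) hint,
    toReal_klDiv_of_measure_eq hac (by simp)]

/-- For `ν = a μ₁ + b μ₂`, the mixture loses exactly the weighted divergences of its components. -/
theorem integral_llr_mixture {α : Type*} [MeasurableSpace α] {μ₁ μ₂ ν κ : Measure α}
    [IsProbabilityMeasure μ₁] [IsProbabilityMeasure μ₂] [IsProbabilityMeasure ν] [SigmaFinite κ]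
    {a b : ℝ≥0} (ha : a ≠ 0) (hb : b ≠ 0) (h : a • μ₁ + b • μ₂ = ν) (hνκ : ν ≪ κ)
    (h₁ : Integrable (llr ν κ) μ₁) (h₂ : Integrable (llr ν κ) μ₂) :
    a * ∫ x, llr μ₁ κ x ∂μ₁ + b * ∫ x, llr μ₂ κ x ∂μ₂
      = ∫ x, llr ν κ x ∂ν + (a * (klDiv μ₁ ν).toReal + b * (klDiv μ₂ ν).toReal) := by
  have hle₁ : a • μ₁ ≤ ν := h ▸ Measure.le_add_right le_rfl
  have hle₂ : b • μ₂ ≤ ν := h ▸ Measure.le_add_left le_rfl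
  rw [integral_llr_eq_add ha hle₁ hνκ h₁, integral_llr_eq_add hb hle₂ hνκ h₂]
  have : ∫ x, llr ν κ x ∂ν = a * ∫ x, llr ν κ x ∂μ₁ + b * ∫ x, llr ν κ x ∂μ₂ := by
    have hsum : ∫ x, llr ν κ x ∂ν = ∫ x, llr ν κ x ∂(a • μ₁ + b • μ₂) := by rw [h]
    rw [hsum, integral_add_measure (h₁.smul_measure_nnreal) (h₂.smul_measure_nnreal),
      integral_smul_nnreal_measure, integral_smul_nnreal_measure]
    rfl
  rw [this]; ring

/-! ### Reweighted plans and data processing -/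

/-- The plan `γ` reweighted so that its second marginal becomes `μ`, its conditional laws given the
second coordinate being kept. -/
noncomputable def reweightPlan {α β : Type*} [MeasurableSpace α] [MeasurableSpace β]
    (γ : Measure (α × β)) (μ : Measure β) : Measure (α × β) :=
  γ.withDensity fun p => μ.rnDeriv (γ.map Prod.snd) p.2

section reweightPlan

variable {α β : Type*} [MeasurableSpace α] [MeasurableSpace β] {γ : Measure (α × β)}
  [IsFiniteMeasure γ] {μ : Measure β} [IsFiniteMeasure μ]

theorem map_snd_reweightPlan (h : μ ≪ γ.map Prod.snd) :
    (reweightPlan γ μ).map Prod.snd = μ := by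
  ext s hs
  rw [Measure.map_apply measurable_snd hs, reweightPlan,
    withDensity_apply _ (measurable_snd hs), ← setLIntegral_map hs
    (Measure.measurable_rnDeriv _ _) measurable_snd, Measure.setLIntegral_rnDeriv h]

theorem isFiniteMeasure_reweightPlan (h : μ ≪ γ.map Prod.snd) :
    IsFiniteMeasure (reweightPlan γ μ) := by
  have : IsFiniteMeasure ((reweightPlan γ μ).map Prod.snd) := by
    rw [map_snd_reweightPlan h]; infer_instance
  exact Measure.isFiniteMeasure_of_map measurable_snd.aemeasurable

theorem isProbabilityMeasure_reweightPlan [IsProbabilityMeasure μ] (h : μ ≪ γ.map Prod.snd) :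
    IsProbabilityMeasure (reweightPlan γ μ) := by
  have : IsProbabilityMeasure ((reweightPlan γ μ).map Prod.snd) := by
    rw [map_snd_reweightPlan h]; infer_instance
  exact Measure.isProbabilityMeasure_of_map Prod.snd

/-- Reweighting depends linearly on the marginal, and the plan is recovered from its own
marginal. -/
theorem reweightPlan_mixture {μ₁ μ₂ : Measure β} [IsFiniteMeasure μ₁] [IsFiniteMeasure μ₂]
    {a b : ℝ≥0} (h : a • μ₁ + b • μ₂ = γ.map Prod.snd) :
    a • reweightPlan γ μ₁ + b • reweightPlan γ μ₂ = γ := by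
  have m₁ : Measurable fun p : α × β => μ₁.rnDeriv (γ.map Prod.snd) p.2 :=
    (Measure.measurable_rnDeriv _ _).comp measurable_snd
  have m₂ : Measurable fun p : α × β => μ₂.rnDeriv (γ.map Prod.snd) p.2 :=
    (Measure.measurable_rnDeriv _ _).comp measurable_snd
  have key : ∀ᵐ y ∂γ.map Prod.snd, (a : ℝ≥0∞) * μ₁.rnDeriv (γ.map Prod.snd) y
      + b * μ₂.rnDeriv (γ.map Prod.snd) y = 1 := by
    have h0 := Measure.rnDeriv_self (γ.map Prod.snd)
    have h1 := Measure.rnDeriv_add (a • μ₁) (b • μ₂) (γ.map Prod.snd)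
    rw [h] at h1
    filter_upwards [h0, h1, Measure.rnDeriv_smul_left μ₁ (γ.map Prod.snd) a,
      Measure.rnDeriv_smul_left μ₂ (γ.map Prod.snd) b] with y h0 h1 h2 h3
    rw [h0, Pi.add_apply, h2, h3] at h1
    exact h1.symm
  have key' := ae_of_ae_map measurable_snd.aemeasurable key
  rw [← Measure.coe_nnreal_smul, ← Measure.coe_nnreal_smul, reweightPlan, reweightPlan,
    ← withDensity_smul _ m₁, ← withDensity_smul _ m₂,
    ← withDensity_add_left (m₁.const_smul _)]
  conv_rhs => rw [← withDensity_one (μ := γ)]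
  exact withDensity_congr_ae key'

/-- The density of the reweighted plan depends on the second coordinate only, so no information is
lost by projecting to it. -/
theorem klDiv_reweightPlan (h : μ ≪ γ.map Prod.snd) :
    klDiv (reweightPlan γ μ) γ = klDiv μ (γ.map Prod.snd) := by
  have m₁ : Measurable fun p : α × β => μ.rnDeriv (γ.map Prod.snd) p.2 :=
    (Measure.measurable_rnDeriv _ _).comp measurable_snd
  have := isFiniteMeasure_reweightPlan h
  rw [klDiv_eq_lintegral_klFun_of_ac h,
    klDiv_eq_lintegral_klFun_of_ac
      (show reweightPlan γ μ ≪ γ from withDensity_absolutelyContinuous _ _),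
    lintegral_map _ measurable_snd]
  · refine lintegral_congr_ae ?_
    filter_upwards [Measure.rnDeriv_withDensity γ m₁] with p hp
    rw [reweightPlan, hp]
  · exact (measurable_klFun.comp (Measure.measurable_rnDeriv _ _).ennreal_toReal).ennreal_ofReal

/-- The data processing inequality for transport along a plan: moving `μ` and the second marginal
of `γ` to the first factor with the same conditional laws does not increase the divergence. -/
theorem klDiv_map_fst_reweightPlan_le (h : μ ≪ γ.map Prod.snd) :
    klDiv ((reweightPlan γ μ).map Prod.fst) (γ.map Prod.fst) ≤ klDiv μ (γ.map Prod.snd) := by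
  have := isFiniteMeasure_reweightPlan h
  rw [← klDiv_reweightPlan h]
  exact klDiv_map_le _ _ measurable_fst

end reweightPlan

/-! ### Finiteness of the relative entropy -/

theorem extendedIntegral_eq_integral {X : Type*} [MeasurableSpace X] {m : Measure X} {g : X → ℝ}
    (hg : Integrable g m) : extendedIntegral m g = ((∫ x, g x ∂m : ℝ) : EReal) := by
  rw [extendedIntegral, integral_eq_lintegral_pos_part_sub_lintegral_neg_part hg, EReal.coe_sub]
  have h1 : ∫⁻ x, ENNReal.ofReal (g x) ∂m ≠ ⊤ := hg.lintegral_lt_top.ne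
  have h2 : ∫⁻ x, ENNReal.ofReal (-g x) ∂m ≠ ⊤ := hg.neg.lintegral_lt_top.ne
  rw [EReal.coe_ennreal_toReal h1, EReal.coe_ennreal_toReal h2]

theorem integrable_of_extendedIntegral_finite {X : Type*} [MeasurableSpace X] {m : Measure X}
    {g : X → ℝ} (hg : AEStronglyMeasurable g m) (htop : extendedIntegral m g ≠ ⊤)
    (hbot : extendedIntegral m g ≠ ⊥) : Integrable g m := by
  have h2 : ∫⁻ x, ENNReal.ofReal (-g x) ∂m ≠ ⊤ := by
    intro h
    exact hbot (by rw [extendedIntegral, h]; simp)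
  have h1 : ∫⁻ x, ENNReal.ofReal (g x) ∂m ≠ ⊤ := by
    intro h
    refine htop ?_
    rw [extendedIntegral, h]
    lift (∫⁻ x, ENNReal.ofReal (-g x) ∂m) to ℝ≥0 using h2 with c
    exact EReal.top_sub_coe c
  refine ⟨hg, ?_⟩
  have h3 : ∀ x, ‖g x‖ₑ = ENNReal.ofReal (g x) + ENNReal.ofReal (-g x) := by
    intro x
    rw [Real.enorm_eq_ofReal_abs]
    rcases le_total 0 (g x) with h | h
    · rw [abs_of_nonneg h, ENNReal.ofReal_of_nonpos (neg_nonpos.2 h), add_zero]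
    · rw [abs_of_nonpos h, ENNReal.ofReal_of_nonpos h, zero_add]
  rw [HasFiniteIntegral, lintegral_congr h3, lintegral_add_left' hg.aemeasurable.ennreal_ofReal]
  exact ENNReal.add_lt_top.2 ⟨h1.lt_top, h2.lt_top⟩

section entropy

variable {X : Type*} [MeasurableSpace X] {m : Measure X} [SigmaFinite m] {V : X → ℝ}
  {μ : ProbabilityMeasure X}

theorem relativeEntropy_eq_integral (hac : (μ : Measure X) ≪ m)
    (hV : ∫⁻ x, ENNReal.ofReal (V x ^ 2) ∂(μ : Measure X) < ∞)
    (hint : Integrable (llr (μ : Measure X) m) (μ : Measure X)) :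
    relativeEntropy m V μ = ((∫ x, llr (μ : Measure X) m x ∂(μ : Measure X) : ℝ) : EReal) := by
  rw [relativeEntropy, if_pos ⟨hac, hV⟩, extendedIntegral_eq_integral
    ((integrable_rnDeriv_mul_log_iff hac).2 hint), integral_rnDeriv_mul_log hac]

theorem finiteEntropy_of_relativeEntropy (htop : relativeEntropy m V μ ≠ ⊤)
    (hbot : relativeEntropy m V μ ≠ ⊥) :
    (μ : Measure X) ≪ m ∧ ∫⁻ x, ENNReal.ofReal (V x ^ 2) ∂(μ : Measure X) < ∞ ∧
      Integrable (llr (μ : Measure X) m) (μ : Measure X) := by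
  rw [relativeEntropy] at htop hbot
  split_ifs at htop hbot with h
  · refine ⟨h.1, h.2, (integrable_rnDeriv_mul_log_iff h.1).1
      (integrable_of_extendedIntegral_finite ?_ htop hbot)⟩
    exact (Real.continuous_mul_log.measurable.comp
      (Measure.measurable_rnDeriv _ m).ennreal_toReal).aestronglyMeasurable
  · exact absurd rfl htop

/-- Comparing `r` with the Gaussian weight `e^{-v²}`: for `s = r e^{v²}`,
`-r log r = r v² - e^{-v²} s log s ≤ r v² + e^{-v²} (1 - s)`. -/
theorem neg_mul_log_le_mul_sq_add_exp {r : ℝ} (hr : 0 ≤ r) (v : ℝ) :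
    -(r * Real.log r) ≤ r * v ^ 2 + Real.exp (-v ^ 2) := by
  rcases hr.eq_or_lt with rfl | hr
  · simp [Real.exp_nonneg]
  have h := Real.negMulLog_le_one_sub_self (x := r * Real.exp (v ^ 2)) (by positivity)
  rw [Real.negMulLog, Real.log_mul hr.ne' (Real.exp_ne_zero _), Real.log_exp] at h
  have h2 := mul_le_mul_of_nonneg_right h (Real.exp_nonneg (-v ^ 2))
  have h3 : Real.exp (v ^ 2) * Real.exp (-v ^ 2) = 1 := by
    rw [← Real.exp_add]; simp
  have h4 : -(r * Real.exp (v ^ 2)) * (Real.log r + v ^ 2) * Real.exp (-v ^ 2)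
      = -(r * (Real.log r + v ^ 2)) := by linear_combination (-(r * (Real.log r + v ^ 2))) * h3
  have h5 : (1 - r * Real.exp (v ^ 2)) * Real.exp (-v ^ 2) = Real.exp (-v ^ 2) - r := by
    linear_combination (-r) * h3
  linarith

/-- Under `∫ e^{-V²} dm ≤ 1` the entropy never takes the value `-∞`. -/
theorem relativeEntropy_ne_bot {d : X → X → ℝ≥0∞} (hV : IsEntropyWeight d m V) :
    relativeEntropy m V μ ≠ ⊥ := by
  rw [relativeEntropy]
  split_ifs with h
  swap
  · exact top_ne_bot
  set ρ := (μ : Measure X).rnDeriv m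
  have hρm : Measurable ρ := Measure.measurable_rnDeriv _ _
  have hneg : ∫⁻ x, ENNReal.ofReal (-((ρ x).toReal * Real.log (ρ x).toReal)) ∂m ≠ ⊤ := by
    have hmV : Measurable fun x => ENNReal.ofReal (V x ^ 2) :=
      (hV.measurable.pow_const 2).ennreal_ofReal
    refine ne_top_of_le_ne_top (b := ∫⁻ x, ENNReal.ofReal (V x ^ 2) ∂(μ : Measure X) + 1) ?_ ?_
    · exact ENNReal.add_ne_top.2 ⟨h.2.ne, by simp⟩
    · calc ∫⁻ x, ENNReal.ofReal (-((ρ x).toReal * Real.log (ρ x).toReal)) ∂m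
          ≤ ∫⁻ x, (ρ x * ENNReal.ofReal (V x ^ 2)
              + ENNReal.ofReal (Real.exp (-(V x) ^ 2))) ∂m := by
            refine lintegral_mono_ae ?_
            filter_upwards [Measure.rnDeriv_lt_top (μ : Measure X) m] with x hx
            refine (ENNReal.ofReal_le_ofReal
              (neg_mul_log_le_mul_sq_add_exp ENNReal.toReal_nonneg (V x))).trans ?_
            rw [ENNReal.ofReal_add (by positivity) (Real.exp_nonneg _),
              ENNReal.ofReal_mul ENNReal.toReal_nonneg, ENNReal.ofReal_toReal hx.ne]
        _ = ∫⁻ x, ENNReal.ofReal (V x ^ 2) ∂(μ : Measure X)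
              + ∫⁻ x, ENNReal.ofReal (Real.exp (-(V x) ^ 2)) ∂m := by
            rw [lintegral_add_left (f := fun x => ρ x * ENNReal.ofReal (V x ^ 2)) (hρm.mul hmV),
              lintegral_rnDeriv_mul h.1 hmV.aemeasurable]
        _ ≤ _ := by gcongr; exact hV.lintegral_exp_le
  rw [extendedIntegral]
  lift (∫⁻ x, ENNReal.ofReal (-((ρ x).toReal * Real.log (ρ x).toReal)) ∂m) to ℝ≥0
    using hneg with c
  have hpos : ((∫⁻ x, ENNReal.ofReal ((ρ x).toReal * Real.log (ρ x).toReal) ∂m : ℝ≥0∞) : EReal)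
      ≠ ⊥ := EReal.coe_ennreal_ne_bot _
  rw [sub_eq_add_neg, Ne, EReal.add_eq_bot_iff]
  push Not
  exact ⟨hpos, EReal.coe_ne_bot (-(c : ℝ))⟩

end entropy

/-! ### Splitting a plan along a mixture -/

/-- Transporting the two components of a mixture along the same plan: the entropy drop of the
mixture is at most the average of the drops of its components, and the costs average exactly. -/
theorem exists_split_plan {X : Type*} [MeasurableSpace X] {m : Measure X} [SigmaFinite m]
    {V : X → ℝ} (c : X × X → ℝ≥0∞) {a b : ℝ≥0} (ha : a ≠ 0) (hb : b ≠ 0)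
    {μ₁ μ₂ μ ν : ProbabilityMeasure X}
    (hμ : a • (μ₁ : Measure X) + b • (μ₂ : Measure X) = μ)
    (γ : ProbabilityMeasure (X × X)) (hγν : (γ : Measure (X × X)).map Prod.fst = ν)
    (hγμ : (γ : Measure (X × X)).map Prod.snd = μ)
    (hμm : (μ : Measure X) ≪ m) (hμi : Integrable (llr (μ : Measure X) m) (μ : Measure X))
    (hνm : (ν : Measure X) ≪ m) (hνi : Integrable (llr (ν : Measure X) m) (ν : Measure X))
    (hνV : ∫⁻ x, ENNReal.ofReal (V x ^ 2) ∂(ν : Measure X) < ∞) :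
    ∃ (γ₁ γ₂ : ProbabilityMeasure (X × X)) (ν₁ ν₂ : ProbabilityMeasure X),
      (γ₁ : Measure (X × X)).map Prod.fst = ν₁ ∧ (γ₁ : Measure (X × X)).map Prod.snd = μ₁ ∧
      (γ₂ : Measure (X × X)).map Prod.fst = ν₂ ∧ (γ₂ : Measure (X × X)).map Prod.snd = μ₂ ∧
      a * ∫⁻ p, c p ∂(γ₁ : Measure (X × X)) + b * ∫⁻ p, c p ∂(γ₂ : Measure (X × X))
        = ∫⁻ p, c p ∂(γ : Measure (X × X)) ∧
      relativeEntropy m V ν₁ = ((∫ x, llr (ν₁ : Measure X) m x ∂(ν₁ : Measure X) : ℝ) : EReal) ∧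
      relativeEntropy m V ν₂ = ((∫ x, llr (ν₂ : Measure X) m x ∂(ν₂ : Measure X) : ℝ) : EReal) ∧
      ∫ x, llr (μ : Measure X) m x ∂(μ : Measure X) - ∫ x, llr (ν : Measure X) m x ∂(ν : Measure X)
        ≤ a * (∫ x, llr (μ₁ : Measure X) m x ∂(μ₁ : Measure X)
            - ∫ x, llr (ν₁ : Measure X) m x ∂(ν₁ : Measure X))
          + b * (∫ x, llr (μ₂ : Measure X) m x ∂(μ₂ : Measure X)
            - ∫ x, llr (ν₂ : Measure X) m x ∂(ν₂ : Measure X)) := by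
  have hμle₁ : a • (μ₁ : Measure X) ≤ μ := hμ ▸ Measure.le_add_right le_rfl
  have hμle₂ : b • (μ₂ : Measure X) ≤ μ := hμ ▸ Measure.le_add_left le_rfl
  have hac₁ : (μ₁ : Measure X) ≪ (γ : Measure (X × X)).map Prod.snd :=
    hγμ ▸ absolutelyContinuous_of_smul_le ha hμle₁
  have hac₂ : (μ₂ : Measure X) ≪ (γ : Measure (X × X)).map Prod.snd :=
    hγμ ▸ absolutelyContinuous_of_smul_le hb hμle₂
  have hmix := reweightPlan_mixture (hμ.trans hγμ.symm)
  have hkl₁ := klDiv_map_fst_reweightPlan_le hac₁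
  have hkl₂ := klDiv_map_fst_reweightPlan_le hac₂
  rw [hγν, hγμ] at hkl₁ hkl₂
  let γ₁ : ProbabilityMeasure (X × X) := ⟨_, isProbabilityMeasure_reweightPlan hac₁⟩
  let γ₂ : ProbabilityMeasure (X × X) := ⟨_, isProbabilityMeasure_reweightPlan hac₂⟩
  let ν₁ : ProbabilityMeasure X := γ₁.map measurable_fst.aemeasurable
  let ν₂ : ProbabilityMeasure X := γ₂.map measurable_fst.aemeasurable
  have hν : a • (ν₁ : Measure X) + b • (ν₂ : Measure X) = ν := by
    change a • (reweightPlan (γ : Measure (X × X)) (μ₁ : Measure X)).map Prod.fst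
      + b • (reweightPlan (γ : Measure (X × X)) (μ₂ : Measure X)).map Prod.fst = _
    rw [← hγν, ← Measure.coe_nnreal_smul, ← Measure.coe_nnreal_smul, ← Measure.map_smul,
      ← Measure.map_smul, ← Measure.map_add _ _ measurable_fst, Measure.coe_nnreal_smul,
      Measure.coe_nnreal_smul, hmix]
  have hνle₁ : a • (ν₁ : Measure X) ≤ ν := hν ▸ Measure.le_add_right le_rfl
  have hνle₂ : b • (ν₂ : Measure X) ≤ ν := hν ▸ Measure.le_add_left le_rfl
  have hfin : ∀ (t : ℝ≥0) (σ : ProbabilityMeasure X), t ≠ 0 → t • (σ : Measure X) ≤ ν →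
      Integrable (llr (ν : Measure X) m) (σ : Measure X) ∧
      relativeEntropy m V σ = ((∫ x, llr (σ : Measure X) m x ∂(σ : Measure X) : ℝ) : EReal) := by
    intro t σ ht hσ
    have hi := integrable_of_smul_le ht hσ hνi
    refine ⟨hi, relativeEntropy_eq_integral
      ((absolutelyContinuous_of_smul_le ht hσ).trans hνm) ?_
      ((integrable_llr_iff_of_smul_le ht hσ hνm).2 hi)⟩
    have h := (lintegral_mono' hσ le_rfl).trans_lt hνV
    rw [← Measure.coe_nnreal_smul, lintegral_smul_measure, smul_eq_mul] at h
    exact (ENNReal.mul_lt_top_iff.1 h).elim And.right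
      (fun h => h.elim (fun h => absurd h (by simpa using ht)) fun h => h ▸ ENNReal.zero_lt_top)
  obtain ⟨hi₁, hE₁⟩ := hfin a ν₁ ha hνle₁
  obtain ⟨hi₂, hE₂⟩ := hfin b ν₂ hb hνle₂
  refine ⟨γ₁, γ₂, ν₁, ν₂, rfl, map_snd_reweightPlan hac₁, rfl, map_snd_reweightPlan hac₂, ?_,
    hE₁, hE₂, ?_⟩
  · conv_rhs => rw [← hmix]
    rw [lintegral_add_measure, ← Measure.coe_nnreal_smul, ← Measure.coe_nnreal_smul,
      lintegral_smul_measure, lintegral_smul_measure]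
    rfl
  · have e1 := integral_llr_mixture ha hb hμ hμm (integrable_of_smul_le ha hμle₁ hμi)
      (integrable_of_smul_le hb hμle₂ hμi)
    have e2 := integral_llr_mixture ha hb hν hνm hi₁ hi₂
    have k1 : (klDiv (ν₁ : Measure X) ν).toReal ≤ (klDiv (μ₁ : Measure X) μ).toReal :=
      ENNReal.toReal_mono (klDiv_ne_top (absolutelyContinuous_of_smul_le ha hμle₁)
        (integrable_llr_of_smul_le ha hμle₁)) hkl₁
    have k2 : (klDiv (ν₂ : Measure X) ν).toReal ≤ (klDiv (μ₂ : Measure X) μ).toReal :=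
      ENNReal.toReal_mono (klDiv_ne_top (absolutelyContinuous_of_smul_le hb hμle₂)
        (integrable_llr_of_smul_le hb hμle₂)) hkl₂
    have k3 := mul_le_mul_of_nonneg_left k1 a.coe_nonneg
    have k4 := mul_le_mul_of_nonneg_left k2 b.coe_nonneg
    linarith

/-! ### Descending slopes and near-optimal plans -/

theorem ne_top_ne_bot_of_descendingSlope_ne_top {Y : Type*} {d : Y → Y → ℝ≥0∞} {f : Y → EReal}
    {y : Y} (h : descendingSlope d f y ≠ ∞) : f y ≠ ⊤ ∧ f y ≠ ⊥ := by
  by_contra h'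
  exact h (by rw [descendingSlope, if_neg h'])

theorem exists_drop_le_of_descendingSlope_lt {Y : Type*} {d : Y → Y → ℝ≥0∞} {f : Y → EReal}
    {y : Y} {t : ℝ≥0} (h : descendingSlope d f y < t) :
    ∃ r : ℝ≥0∞, 0 < r ∧ ∀ z, d z y < r → (f y - f z).toENNReal ≤ t * d z y := by
  have hfin := ne_top_ne_bot_of_descendingSlope_ne_top h.ne_top
  rw [descendingSlope, if_pos hfin] at h
  simp only [iInf_lt_iff] at h
  obtain ⟨r, hr, h⟩ := h
  refine ⟨r, hr, fun z hz => ?_⟩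
  by_cases hzy : z = y
  · rw [hzy, EReal.sub_self hfin.1 hfin.2]
    simp
  · refine (ENNReal.div_le_iff_le_mul (Or.inr ENNReal.coe_ne_top) (Or.inl hz.ne_top)).1 ?_
    refine le_trans ?_ h.le
    exact le_iSup_of_le z (le_iSup_of_le hzy (le_iSup_of_le hz le_rfl))

/-- The bound on the drops also covers the points `z` with `d z y = 0`, where the quotient in the
definition of the slope is `0 / 0 = 0`. -/
theorem descendingSlope_le_of_forall_drop_le {Y : Type*} {d : Y → Y → ℝ≥0∞} {f : Y → EReal}
    {y : Y} (hfin : f y ≠ ⊤ ∧ f y ≠ ⊥) {r t : ℝ≥0∞} (hr : 0 < r)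
    (h : ∀ z, d z y < r → (f y - f z).toENNReal ≤ t * d z y) : descendingSlope d f y ≤ t := by
  rw [descendingSlope, if_pos hfin]
  refine iInf₂_le_of_le r hr (iSup_le fun z => iSup_le fun _ => iSup_le fun hz => ?_)
  exact ENNReal.div_le_of_le_mul (h z hz)

theorem wassersteinTwo_sq {X : Type*} [MeasurableSpace X] (d : X → X → ℝ≥0∞)
    (μ ν : ProbabilityMeasure X) : wassersteinTwo d μ ν ^ 2 =
      ⨅ (γ : ProbabilityMeasure (X × X)) (_ : (γ : Measure (X × X)).map Prod.fst = (μ : Measure X))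
      (_ : (γ : Measure (X × X)).map Prod.snd = (ν : Measure X)),
        ∫⁻ p, d p.1 p.2 ^ 2 ∂(γ : Measure (X × X)) := by
  rw [wassersteinTwo, ← ENNReal.rpow_natCast, ← ENNReal.rpow_mul]
  norm_num

theorem wassersteinTwo_sq_le {X : Type*} [MeasurableSpace X] (d : X → X → ℝ≥0∞)
    {μ ν : ProbabilityMeasure X} {γ : ProbabilityMeasure (X × X)}
    (h₁ : (γ : Measure (X × X)).map Prod.fst = μ) (h₂ : (γ : Measure (X × X)).map Prod.snd = ν) :
    wassersteinTwo d μ ν ^ 2 ≤ ∫⁻ p, d p.1 p.2 ^ 2 ∂(γ : Measure (X × X)) := by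
  rw [wassersteinTwo_sq]
  exact iInf_le_of_le γ (iInf_le_of_le h₁ (iInf_le_of_le h₂ le_rfl))

theorem exists_coupling_of_wassersteinTwo_sq_lt {X : Type*} [MeasurableSpace X]
    {d : X → X → ℝ≥0∞} {μ ν : ProbabilityMeasure X} {c : ℝ≥0∞}
    (h : wassersteinTwo d μ ν ^ 2 < c) :
    ∃ γ : ProbabilityMeasure (X × X), (γ : Measure (X × X)).map Prod.fst = μ ∧
      (γ : Measure (X × X)).map Prod.snd = ν ∧ ∫⁻ p, d p.1 p.2 ^ 2 ∂(γ : Measure (X × X)) < c := by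
  rw [wassersteinTwo_sq] at h
  simp only [iInf_lt_iff] at h
  obtain ⟨γ, h₁, h₂, h⟩ := h
  exact ⟨γ, h₁, h₂, h⟩

/-! ### Convexity of the squared slope -/

/-- The weighted Cauchy–Schwarz inequality with two summands. -/
theorem sq_add_mul_le_mul_add_sq (a b t₁ t₂ : ℝ≥0) {w₁ w₂ : ℝ≥0∞} (h₁ : w₁ ≠ ∞) (h₂ : w₂ ≠ ∞) :
    ((a : ℝ≥0∞) * (t₁ * w₁) + b * (t₂ * w₂)) ^ 2
      ≤ (a * (t₁ : ℝ≥0∞) ^ 2 + b * (t₂ : ℝ≥0∞) ^ 2) * (a * w₁ ^ 2 + b * w₂ ^ 2) := by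
  lift w₁ to ℝ≥0 using h₁
  lift w₂ to ℝ≥0 using h₂
  norm_cast
  rw [← NNReal.coe_le_coe]
  push_cast
  have h : 0 ≤ (a : ℝ) * b * ((t₁ : ℝ) * w₂ - t₂ * w₁) ^ 2 := by positivity
  linarith [h, show ((a : ℝ) * t₁ ^ 2 + b * t₂ ^ 2) * (a * w₁ ^ 2 + b * w₂ ^ 2)
    - (a * (t₁ * w₁) + b * (t₂ * w₂)) ^ 2 = a * b * (t₁ * w₂ - t₂ * w₁) ^ 2 by ring]

section slope

variable {X : Type*} [MeasurableSpace X] {d : X → X → ℝ≥0∞} {m : Measure X} [SigmaFinite m]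
  {V : X → ℝ} {μ₁ μ₂ : ProbabilityMeasure X} {a b : ℝ≥0}

/-- The mixture of two measures of finite entropy has finite entropy. -/
theorem finiteEntropy_mixture (hab : a + b = 1) (ha : a ≠ 0) (hb : b ≠ 0)
    (h₁ : relativeEntropy m V μ₁ ≠ ⊤ ∧ relativeEntropy m V μ₁ ≠ ⊥)
    (h₂ : relativeEntropy m V μ₂ ≠ ⊤ ∧ relativeEntropy m V μ₂ ≠ ⊥) :
    (linearInterpolation a b hab μ₁ μ₂ : Measure X) ≪ m ∧
      ∫⁻ x, ENNReal.ofReal (V x ^ 2) ∂(linearInterpolation a b hab μ₁ μ₂ : Measure X) < ∞ ∧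
      Integrable (llr (linearInterpolation a b hab μ₁ μ₂ : Measure X) m)
        (linearInterpolation a b hab μ₁ μ₂ : Measure X) := by
  obtain ⟨ac₁, V₁, i₁⟩ := finiteEntropy_of_relativeEntropy h₁.1 h₁.2
  obtain ⟨ac₂, V₂, i₂⟩ := finiteEntropy_of_relativeEntropy h₂.1 h₂.2
  set μ := linearInterpolation a b hab μ₁ μ₂
  have hμ : (μ : Measure X) = a • (μ₁ : Measure X) + b • (μ₂ : Measure X) := rfl
  have ac : (μ : Measure X) ≪ m := by
    rw [hμ]
    exact Measure.AbsolutelyContinuous.add_left (ac₁.smul_left a) (ac₂.smul_left b)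
  refine ⟨ac, ?_, ?_⟩
  · rw [hμ, lintegral_add_measure, ← Measure.coe_nnreal_smul, ← Measure.coe_nnreal_smul,
      lintegral_smul_measure, lintegral_smul_measure]
    exact ENNReal.add_lt_top.2 ⟨ENNReal.mul_lt_top ENNReal.coe_lt_top V₁,
      ENNReal.mul_lt_top ENNReal.coe_lt_top V₂⟩
  · have j₁ := (integrable_llr_iff_of_smul_le ha
      (show a • (μ₁ : Measure X) ≤ μ from hμ ▸ Measure.le_add_right le_rfl) ac).1 i₁
    have j₂ := (integrable_llr_iff_of_smul_le hb
      (show b • (μ₂ : Measure X) ≤ μ from hμ ▸ Measure.le_add_left le_rfl) ac).1 i₂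
    conv => arg 2; rw [hμ]
    exact j₁.smul_measure_nnreal.add_measure j₂.smul_measure_nnreal

/-- A plan of small cost moves `μ₁` and `μ₂` by less than `r₁` and `r₂`, a range in which the entropy
drops at most at the rates `t₁` and `t₂`; the two rates are combined by Cauchy–Schwarz. -/
theorem sq_drop_mixture_le (hab : a + b = 1) (ha : a ≠ 0) (hb : b ≠ 0)
    (hV : IsEntropyWeight d m V)
    (h₁ : relativeEntropy m V μ₁ ≠ ⊤ ∧ relativeEntropy m V μ₁ ≠ ⊥)
    (h₂ : relativeEntropy m V μ₂ ≠ ⊤ ∧ relativeEntropy m V μ₂ ≠ ⊥)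
    {t₁ t₂ : ℝ≥0} {r₁ r₂ : ℝ≥0∞}
    (hr₁ : ∀ σ, wassersteinTwo d σ μ₁ < r₁ →
      (relativeEntropy m V μ₁ - relativeEntropy m V σ).toENNReal ≤ t₁ * wassersteinTwo d σ μ₁)
    (hr₂ : ∀ σ, wassersteinTwo d σ μ₂ < r₂ →
      (relativeEntropy m V μ₂ - relativeEntropy m V σ).toENNReal ≤ t₂ * wassersteinTwo d σ μ₂)
    {ν : ProbabilityMeasure X} {γ : ProbabilityMeasure (X × X)}
    (hγν : (γ : Measure (X × X)).map Prod.fst = ν)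
    (hγμ : (γ : Measure (X × X)).map Prod.snd = linearInterpolation a b hab μ₁ μ₂)
    (hγ₁ : ∫⁻ p, d p.1 p.2 ^ 2 ∂(γ : Measure (X × X)) < a * r₁ ^ 2)
    (hγ₂ : ∫⁻ p, d p.1 p.2 ^ 2 ∂(γ : Measure (X × X)) < b * r₂ ^ 2) :
    (relativeEntropy m V (linearInterpolation a b hab μ₁ μ₂)
        - relativeEntropy m V ν).toENNReal ^ 2
      ≤ (a * (t₁ : ℝ≥0∞) ^ 2 + b * (t₂ : ℝ≥0∞) ^ 2)
        * ∫⁻ p, d p.1 p.2 ^ 2 ∂(γ : Measure (X × X)) := by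
  obtain ⟨ac₁, V₁, i₁⟩ := finiteEntropy_of_relativeEntropy h₁.1 h₁.2
  obtain ⟨ac₂, V₂, i₂⟩ := finiteEntropy_of_relativeEntropy h₂.1 h₂.2
  obtain ⟨ac, Vμ, i⟩ := finiteEntropy_mixture hab ha hb h₁ h₂
  have hE := relativeEntropy_eq_integral ac Vμ i
  have hE₁ := relativeEntropy_eq_integral ac₁ V₁ i₁
  have hE₂ := relativeEntropy_eq_integral ac₂ V₂ i₂
  -- If `Ent(ν) = ∞` there is no drop.
  by_cases hν : relativeEntropy m V ν = ⊤
  · rw [hν, hE]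
    simp
  obtain ⟨acν, Vν, iν⟩ := finiteEntropy_of_relativeEntropy hν (relativeEntropy_ne_bot hV)
  have hEν := relativeEntropy_eq_integral acν Vν iν
  obtain ⟨γ₁, γ₂, ν₁, ν₂, hγν₁, hγμ₁, hγν₂, hγμ₂, hcost, hF₁, hF₂, hdrop⟩ :=
    exists_split_plan (V := V) (fun p => d p.1 p.2 ^ 2) ha hb rfl γ hγν hγμ ac i acν iν Vν
  have hW₁ := wassersteinTwo_sq_le d hγν₁ hγμ₁
  have hW₂ := wassersteinTwo_sq_le d hγν₂ hγμ₂
  have hlt₁ : wassersteinTwo d ν₁ μ₁ < r₁ := by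
    refine lt_of_pow_lt_pow_left' 2 (hW₁.trans_lt ?_)
    refine lt_of_mul_lt_mul_left' (a := (a : ℝ≥0∞)) (lt_of_le_of_lt ?_ hγ₁)
    exact hcost ▸ le_self_add
  have hlt₂ : wassersteinTwo d ν₂ μ₂ < r₂ := by
    refine lt_of_pow_lt_pow_left' 2 (hW₂.trans_lt ?_)
    refine lt_of_mul_lt_mul_left' (a := (b : ℝ≥0∞)) (lt_of_le_of_lt ?_ hγ₂)
    exact hcost ▸ le_add_self
  have hd₁ := hr₁ ν₁ hlt₁
  have hd₂ := hr₂ ν₂ hlt₂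
  rw [hE₁, hF₁, ← EReal.coe_sub, EReal.toENNReal_of_ne_top (EReal.coe_ne_top _),
    EReal.toReal_coe] at hd₁
  rw [hE₂, hF₂, ← EReal.coe_sub, EReal.toENNReal_of_ne_top (EReal.coe_ne_top _),
    EReal.toReal_coe] at hd₂
  rw [hE, hEν, ← EReal.coe_sub, EReal.toENNReal_of_ne_top (EReal.coe_ne_top _), EReal.toReal_coe]
  refine (pow_le_pow_left' ((ENNReal.ofReal_le_ofReal hdrop).trans
    (ENNReal.ofReal_add_le.trans ?_)) 2).trans
    ((sq_add_mul_le_mul_add_sq a b t₁ t₂ hlt₁.ne_top hlt₂.ne_top).trans ?_)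
  · rw [ENNReal.ofReal_mul a.coe_nonneg, ENNReal.ofReal_mul b.coe_nonneg,
      ENNReal.ofReal_coe_nnreal, ENNReal.ofReal_coe_nnreal]
    gcongr
  · rw [← hcost]
    gcongr

/-- The convexity estimate, with rates `t₁`, `t₂` strictly larger than the slopes of the
components. -/
theorem descendingSlope_mixture_sq_le (hab : a + b = 1) (ha : a ≠ 0) (hb : b ≠ 0)
    (hV : IsEntropyWeight d m V) {t₁ t₂ : ℝ≥0}
    (ht₁ : descendingSlope (wassersteinTwo d) (relativeEntropy m V) μ₁ < t₁)
    (ht₂ : descendingSlope (wassersteinTwo d) (relativeEntropy m V) μ₂ < t₂) :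
    descendingSlope (wassersteinTwo d) (relativeEntropy m V)
        (linearInterpolation a b hab μ₁ μ₂) ^ 2
      ≤ a * (t₁ : ℝ≥0∞) ^ 2 + b * (t₂ : ℝ≥0∞) ^ 2 := by
  have h₁ := ne_top_ne_bot_of_descendingSlope_ne_top ht₁.ne_top
  have h₂ := ne_top_ne_bot_of_descendingSlope_ne_top ht₂.ne_top
  obtain ⟨ac, Vμ, i⟩ := finiteEntropy_mixture hab ha hb h₁ h₂
  have hE := relativeEntropy_eq_integral ac Vμ i
  obtain ⟨r₁, hr₁, hd₁⟩ := exists_drop_le_of_descendingSlope_lt ht₁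
  obtain ⟨r₂, hr₂, hd₂⟩ := exists_drop_le_of_descendingSlope_lt ht₂
  set T : ℝ≥0∞ := a * (t₁ : ℝ≥0∞) ^ 2 + b * (t₂ : ℝ≥0∞) ^ 2 with hT
  have hTtop : T ≠ ∞ := by
    rw [hT]; norm_cast; exact ENNReal.coe_ne_top
  -- Plans of cost less than `R` split into plans of cost less than `r₁ ^ 2` and `r₂ ^ 2`.
  have hR : 0 < min (a * r₁ ^ 2) (b * r₂ ^ 2) := by
    have ha' : (0 : ℝ≥0∞) < a := by simpa using pos_iff_ne_zero.2 ha
    have hb' : (0 : ℝ≥0∞) < b := by simpa using pos_iff_ne_zero.2 hb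
    exact lt_min (ENNReal.mul_pos ha'.ne' (pow_ne_zero 2 hr₁.ne'))
      (ENNReal.mul_pos hb'.ne' (pow_ne_zero 2 hr₂.ne'))
  set R : ℝ≥0∞ := min (a * r₁ ^ 2) (b * r₂ ^ 2)
  have hsqrt : ∀ s : ℝ≥0∞, (s ^ (1 / 2 : ℝ)) ^ 2 = s := fun s => by
    rw [← ENNReal.rpow_natCast, ← ENNReal.rpow_mul]
    norm_num
  suffices h : descendingSlope (wassersteinTwo d) (relativeEntropy m V)
      (linearInterpolation a b hab μ₁ μ₂) ≤ T ^ (1 / 2 : ℝ) from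
    (pow_le_pow_left' h 2).trans (hsqrt T).le
  refine descendingSlope_le_of_forall_drop_le (r := R ^ (1 / 2 : ℝ))
    ⟨hE ▸ EReal.coe_ne_top _, hE ▸ EReal.coe_ne_bot _⟩
    (ENNReal.rpow_pos_of_nonneg hR (by norm_num)) fun ν hν => ?_
  have hν' : wassersteinTwo d ν (linearInterpolation a b hab μ₁ μ₂) ^ 2 < R := by
    rw [← hsqrt R]
    exact ENNReal.pow_lt_pow_left two_ne_zero hν
  refine (ENNReal.pow_le_pow_left_iff two_ne_zero).1 ?_
  rw [mul_pow, hsqrt]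
  -- The bound holds with the cost of every plan of small cost, hence for the infimum of the costs.
  by_contra! hlt
  rw [mul_comm, ← ENNReal.lt_div_iff_mul_lt (Or.inr hν'.ne_top) (Or.inl hTtop)] at hlt
  obtain ⟨γ, hγν, hγμ, hγ⟩ := exists_coupling_of_wassersteinTwo_sq_lt (lt_min hlt hν')
  obtain ⟨hγ', hγR⟩ := lt_min_iff.1 hγ
  rw [ENNReal.lt_div_iff_mul_lt (Or.inr hγR.ne_top) (Or.inl hTtop), mul_comm] at hγ'
  exact hγ'.not_ge (sq_drop_mixture_le hab ha hb hV h₁ h₂ hd₁ hd₂ hγν hγμ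
    (hγR.trans_le (min_le_left _ _)) (hγR.trans_le (min_le_right _ _)))

end slope

theorem mainTheorem8 {X : Type*} [TopologicalSpace X] [MeasurableSpace X] [BorelSpace X]
    (d : X → X → ℝ≥0∞) (hX : IsPolishExtendedSpace X d)
    (m : Measure X) [SigmaFinite m] (V : X → ℝ) (hV : IsEntropyWeight d m V)
    (μ₁ μ₂ : ProbabilityMeasure X) (a b : ℝ≥0) (hab : a + b = 1) :
    descendingSlope (wassersteinTwo d) (relativeEntropy m V)
        (linearInterpolation a b hab μ₁ μ₂) ^ 2
      ≤ a * descendingSlope (wassersteinTwo d) (relativeEntropy m V) μ₁ ^ 2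
        + b * descendingSlope (wassersteinTwo d) (relativeEntropy m V) μ₂ ^ 2 := by
  rcases eq_or_ne a 0 with rfl | ha
  · obtain rfl : b = 1 := by simpa using hab
    have : linearInterpolation 0 1 hab μ₁ μ₂ = μ₂ :=
      Subtype.ext (by simp [linearInterpolation])
    simp [this]
  rcases eq_or_ne b 0 with rfl | hb
  · obtain rfl : a = 1 := by simpa using hab
    have : linearInterpolation 1 0 hab μ₁ μ₂ = μ₁ :=
      Subtype.ext (by simp [linearInterpolation])
    simp [this]
  have ha' : (a : ℝ≥0∞) ≠ 0 := by simpa using ha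
  have hb' : (b : ℝ≥0∞) ≠ 0 := by simpa using hb
  by_cases h₁ : descendingSlope (wassersteinTwo d) (relativeEntropy m V) μ₁ = ∞
  · simp [h₁, ENNReal.mul_top ha']
  by_cases h₂ : descendingSlope (wassersteinTwo d) (relativeEntropy m V) μ₂ = ∞
  · simp [h₂, ENNReal.mul_top hb']
  generalize hs₁ : descendingSlope (wassersteinTwo d) (relativeEntropy m V) μ₁ = s₁ at *
  generalize hs₂ : descendingSlope (wassersteinTwo d) (relativeEntropy m V) μ₂ = s₂ at *
  lift s₁ to ℝ≥0 using h₁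
  lift s₂ to ℝ≥0 using h₂
  have hlim : Tendsto (fun ε : ℝ≥0 => (a : ℝ≥0∞) * ((s₁ + ε : ℝ≥0) : ℝ≥0∞) ^ 2
      + b * ((s₂ + ε : ℝ≥0) : ℝ≥0∞) ^ 2) (𝓝[>] 0)
      (𝓝 (a * (s₁ : ℝ≥0∞) ^ 2 + b * (s₂ : ℝ≥0∞) ^ 2)) := by
    norm_cast
    have : Continuous fun ε : ℝ≥0 => a * (s₁ + ε) ^ 2 + b * (s₂ + ε) ^ 2 := by fun_prop
    simpa using (this.tendsto 0).mono_left nhdsWithin_le_nhds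
  refine ge_of_tendsto hlim (eventually_mem_nhdsWithin.mono fun ε hε => ?_)
  have hε' : 0 < ε := hε
  exact descendingSlope_mixture_sq_le hab ha hb hV
    (hs₁ ▸ ENNReal.coe_lt_coe.2 (lt_add_of_pos_right _ hε'))
    (hs₂ ▸ ENNReal.coe_lt_coe.2 (lt_add_of_pos_right _ hε'))
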